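/- Let $(\mathcal M,g,A)$ be a K\"ahler manifold of real dimension $n$: $\mathcal M$ is a smooth $n$-manifold with a smooth Riemannian metric $g$ with Levi-Civita connection $\nabla^g$, and $A$ is a smooth $(1,1)$-tensor field with $A^2=-I$, $g(AX,AY)=g(X,Y)$ and $\nabla^gA=0$. For a smooth 1-form $\pi$ (the generator) let $$\nabla^1_XY=\nabla^g_XY-\pi(X)\,AY$$ be the associated quarter-symmetric metric $A$-connection, and put $\nabla^2_XY=\nabla^1_YX+[X,Y]$. Define the curvature tensors of the first, third and fifth kind by $$R^1(X,Y)Z=\nabla^1_X\nabla^1_YZ-\nabla^1_Y\nabla^1_XZ-\nabla^1_{[X,Y]}Z,$$ $$R^3(X,Y)Z=\nabla^2_X\nabla^1_YZ-\nabla^1_Y\nabla^2_XZ+\nabla^2_{\nabla^1_YX}Z-\nabla^1_{\nabla^2_XY}Z,$$ $$R^5(X,Y)Z=\tfrac12\big(\nabla^1_X\nabla^1_YZ-\nabla^2_Y\nabla^1_XZ+\nabla^2_X\nabla^2_YZ-\nabla^1_Y\nabla^2_XZ-\nabla^1_{[X,Y]}Z-\nabla^2_{[X,Y]}Z\big),$$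 let $R^g$ be the curvature tensor $R^g(X,Y)Z=\nabla^g_X\nabla^g_YZ-\nabla^g_Y\nabla^g_XZ-\nabla^g_{[X,Y]}Z$, and let $Ric^\theta(Y,Z)=\mathrm{Trace}\{X\mapsto R^\theta(X,Y)Z\}$ for $\theta\in\{1,3,5,g\}$ and ${}'R^3(X,Y)=\mathrm{Trace}\{Z\mapsto R^3(X,Y)Z\}$. Set $$\begin{aligned}H^5(X,Y)Z={}&R^5(X,Y)Z+\tfrac1{n-1}\big(Ric^5(X,Y)Z-Ric^5(Y,Z)X\big)-\tfrac1{2(n-1)}\big(Ric^1(X,Y)Z-Ric^1(Y,Z)X\big)\\&-\tfrac1{2(n-1)}\big({}'R^3(AY,AX)Z-{}'R^3(AZ,AY)X\big)\\&+\tfrac12\big(Ric^1(Y,AX)AZ-Ric^3(Z,AY)AX-{}'R^3(AZ,X)AY\big).\end{aligned}$$ Then for every smooth 1-form $\pi$ and all smooth vector fields $X,Y,Z$, $$H^5(X,Y)Z=R^g(X,Y)Z+\tfrac1{2(n-1)}\big(Ric^g(X,Y)Z-Ric^g(Y,Z)X\big)+\tfrac12\big(Ric^g(AX,Y)AZ-Ric^g(AY,Z)AX\big).$$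 In particular $H^5$ is independent of the generator: it is the same tensor for any two smooth 1-forms $\pi,\pi'$. -/

import Mathlib

open scoped Manifold ContDiff Bundle

noncomputable section

namespace KahlerQS

/-- A (not necessarily continuous) vector field on an `n`-dimensional manifold. -/
abbrev VF (n : ℕ) (M : Type*) [TopologicalSpace M] [ChartedSpace (EuclideanSpace ℝ (Fin n)) M] :=
  (x : M) → TangentSpace (𝓡 n) x

/-- An affine connection, that is, a covariant derivative on the tangent bundle.
In Mathlib's argument order `∇_X Y` at `x` is `D Y x (X x)`. -/
abbrev AffineConnection (n : ℕ) (M : Type*) [TopologicalSpace M]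
    [ChartedSpace (EuclideanSpace ℝ (Fin n)) M] [IsManifold (𝓡 n) ∞ M] :=
  CovariantDerivative (𝓡 n) (EuclideanSpace ℝ (Fin n)) (fun x : M => TangentSpace (𝓡 n) x)

/-- A field of endomorphisms of the tangent spaces. -/
abbrev EndField (n : ℕ) (M : Type*) [TopologicalSpace M]
    [ChartedSpace (EuclideanSpace ℝ (Fin n)) M] :=
  (x : M) → TangentSpace (𝓡 n) x →L[ℝ] TangentSpace (𝓡 n) x

/-- A field of covectors. -/
abbrev CovectorField (n : ℕ) (M : Type*) [TopologicalSpace M]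
    [ChartedSpace (EuclideanSpace ℝ (Fin n)) M] :=
  (x : M) → TangentSpace (𝓡 n) x →L[ℝ] ℝ

section Defs

variable {n : ℕ} {M : Type*} [TopologicalSpace M] [ChartedSpace (EuclideanSpace ℝ (Fin n)) M]

/-- The vector field `AX`. -/
def EndField.app (A : EndField n M) (X : VF n M) : VF n M := fun x => A x (X x)

variable [IsManifold (𝓡 n) ∞ M]

/-- Smoothness of a vector field. -/
def SmoothVF (X : VF n M) : Prop :=
  ContMDiff (𝓡 n) ((𝓡 n).prod 𝓘(ℝ, EuclideanSpace ℝ (Fin n))) ∞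
    (fun x => Bundle.TotalSpace.mk' (EuclideanSpace ℝ (Fin n)) x (X x))

/-- Smoothness of an endomorphism field, as a section of `Hom(TM, TM)`. -/
def SmoothEnd (A : EndField n M) : Prop :=
  ContMDiff (𝓡 n)
    ((𝓡 n).prod 𝓘(ℝ, EuclideanSpace ℝ (Fin n) →L[ℝ] EuclideanSpace ℝ (Fin n))) ∞
    (fun x => Bundle.TotalSpace.mk'
      (EuclideanSpace ℝ (Fin n) →L[ℝ] EuclideanSpace ℝ (Fin n))
      (E := fun x : M => TangentSpace (𝓡 n) x →L[ℝ] TangentSpace (𝓡 n) x) x (A x))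

/-- Smoothness of a covector field, as a section of `Hom(TM, ℝ)`: a smooth 1-form. -/
def SmoothForm (η : CovectorField n M) : Prop :=
  ContMDiff (𝓡 n) ((𝓡 n).prod 𝓘(ℝ, EuclideanSpace ℝ (Fin n) →L[ℝ] ℝ)) ∞
    (fun x => Bundle.TotalSpace.mk' (EuclideanSpace ℝ (Fin n) →L[ℝ] ℝ)
      (E := fun x : M => TangentSpace (𝓡 n) x →L[ℝ] Bundle.Trivial M ℝ x) x (η x))

/-- `∇¹_X Y` as an operation on vector fields. -/
def nabla1 (D : AffineConnection n M) (X Y : VF n M) : VF n M := fun x => D Y x (X x)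

/-- The conjugate connection `∇²_X Y = ∇¹_Y X + [X, Y]`. -/
def nabla2 (D : AffineConnection n M) (X Y : VF n M) : VF n M :=
  nabla1 D Y X + VectorField.mlieBracket (𝓡 n) X Y

/-- Curvature tensor of the first kind (the usual curvature tensor)
`∇¹_X ∇¹_Y Z - ∇¹_Y ∇¹_X Z - ∇¹_[X,Y] Z`. -/
def curv1 (D : AffineConnection n M) (X Y Z : VF n M) : VF n M :=
  nabla1 D X (nabla1 D Y Z) - nabla1 D Y (nabla1 D X Z)
    - nabla1 D (VectorField.mlieBracket (𝓡 n) X Y) Z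

/-- Curvature tensor of the third kind
`∇²_X ∇¹_Y Z - ∇¹_Y ∇²_X Z + ∇²_{∇¹_Y X} Z - ∇¹_{∇²_X Y} Z`. -/
def curv3 (D : AffineConnection n M) (X Y Z : VF n M) : VF n M :=
  nabla2 D X (nabla1 D Y Z) - nabla1 D Y (nabla2 D X Z)
    + nabla2 D (nabla1 D Y X) Z - nabla1 D (nabla2 D X Y) Z

/-- Curvature tensor of the fifth kind
`(∇¹_X ∇¹_Y Z - ∇²_Y ∇¹_X Z + ∇²_X ∇²_Y Z - ∇¹_Y ∇²_X Z - ∇¹_[X,Y] Z - ∇²_[X,Y] Z) / 2`. -/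
def curv5 (D : AffineConnection n M) (X Y Z : VF n M) : VF n M :=
  (1 / 2 : ℝ) • (nabla1 D X (nabla1 D Y Z) - nabla2 D Y (nabla1 D X Z)
    + nabla2 D X (nabla2 D Y Z) - nabla1 D Y (nabla2 D X Z)
    - nabla1 D (VectorField.mlieBracket (𝓡 n) X Y) Z
    - nabla2 D (VectorField.mlieBracket (𝓡 n) X Y) Z)

open Classical in
/-- The trace of a linear endomorphism of `T_xM` given as a bare function
(junk value `0` if the function is not linear). -/
def traceAt (x : M) (f : TangentSpace (𝓡 n) x → TangentSpace (𝓡 n) x) : ℝ :=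
  if h : IsLinearMap ℝ f then LinearMap.trace ℝ (TangentSpace (𝓡 n) x) (h.mk' f) else 0

/-- Ricci tensor `(Y, Z) ↦ Trace {X ↦ R(X,Y)Z}`. A tangent vector at `x` is inserted into `R`
through an extension to a vector field that is smooth near `x`. -/
def ric (R : VF n M → VF n M → VF n M → VF n M) (Y Z : VF n M) (x : M) : ℝ :=
  traceAt x (fun u => R (FiberBundle.extend (EuclideanSpace ℝ (Fin n)) u) Y Z x)

/-- The trace on the last argument, `(X, Y) ↦ Trace {Z ↦ R(X,Y)Z}`. -/
def ric' (R : VF n M → VF n M → VF n M → VF n M) (X Y : VF n M) (x : M) : ℝ :=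
  traceAt x (fun u => R X Y (FiberBundle.extend (EuclideanSpace ℝ (Fin n)) u) x)

/-- The quarter-symmetric connection `∇¹_X Y = ∇_X Y - η(X) AY` with generator `η`. -/
def qsConnection (D : AffineConnection n M) (A : EndField n M) (η : CovectorField n M) :
    AffineConnection n M where
  toFun Y x := D Y x - (η x).smulRight (A x (Y x))
  isCovariantDerivativeOnUniv :=
    { add := by
        intro Y Y' x hY hY' _
        rw [D.isCovariantDerivativeOn.add hY hY']
        ext u
        simp only [Pi.add_apply, map_add, sub_apply,
          add_apply, ContinuousLinearMap.smulRight_apply]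
        module
      leibniz := by
        intro Y f x hY hf _
        rw [D.isCovariantDerivativeOn.leibniz hY hf]
        ext u
        simp only [Pi.smul_apply', map_smul, sub_apply,
          add_apply, smul_apply,
          ContinuousLinearMap.smulRight_apply]
        module }

/-- The tensor `H⁵(X,Y)Z` of the quarter-symmetric connection with generator `η`. -/
def H5 (D : AffineConnection n M) (A : EndField n M) (η : CovectorField n M)
    (X Y Z : VF n M) (x : M) : TangentSpace (𝓡 n) x :=
  let R1 := curv1 (qsConnection D A η)
  let R3 := curv3 (qsConnection D A η)
  let R5 := curv5 (qsConnection D A η)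
  R5 X Y Z x
    + (1 / ((n : ℝ) - 1)) • (ric R5 X Y x • Z x - ric R5 Y Z x • X x)
    - (1 / (2 * ((n : ℝ) - 1))) • (ric R1 X Y x • Z x - ric R1 Y Z x • X x)
    - (1 / (2 * ((n : ℝ) - 1))) •
        (ric' R3 (A.app Y) (A.app X) x • Z x - ric' R3 (A.app Z) (A.app Y) x • X x)
    + (1 / 2 : ℝ) • (ric R1 Y (A.app X) x • A x (Z x) - ric R3 Z (A.app Y) x • A x (X x)
        - ric' R3 (A.app Z) X x • A x (Y x))

variable [Bundle.RiemannianBundle (fun x : M => TangentSpace (𝓡 n) x)]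
  [IsContMDiffRiemannianBundle (𝓡 n) ∞ (EuclideanSpace ℝ (Fin n))
    (fun x : M => TangentSpace (𝓡 n) x)]

/-- A smooth Riemannian metric is in particular of class `C¹`. -/
instance instC1Metric : IsContMDiffRiemannianBundle (𝓡 n) 1 (EuclideanSpace ℝ (Fin n))
    (fun x : M => TangentSpace (𝓡 n) x) :=
  IsContMDiffRiemannianBundle.of_le (n := ∞) (by simp)

/-- `D` is the Levi-Civita connection: smooth, metric and torsion-free. -/
structure IsLeviCivita (D : AffineConnection n M) : Prop where
  smooth : CovariantDerivative.ContMDiffCovariantDerivative D ∞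
  metric : D.IsMetricCompatible
  torsion_free : D.torsion = 0

/-- `(M, g, A)` is a Kähler manifold, `D` being the Levi-Civita connection of `g`: `A` is a smooth
almost complex structure, `g` is `A`-invariant, and `(∇_X A)Y = ∇_X (AY) - A ∇_X Y = 0` at each
point where `Y` is differentiable. -/
structure IsKahler (D : AffineConnection n M) (A : EndField n M) : Prop where
  smooth : SmoothEnd A
  sq : ∀ (x : M) (u : TangentSpace (𝓡 n) x), A x (A x u) = -u
  isometric : ∀ (x : M) (u v : TangentSpace (𝓡 n) x), inner ℝ (A x u) (A x v) = inner ℝ u v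
  parallel : ∀ (Y : VF n M) (x : M),
    MDifferentiableAt (𝓡 n) ((𝓡 n).prod 𝓘(ℝ, EuclideanSpace ℝ (Fin n)))
      (fun y => Bundle.TotalSpace.mk' (EuclideanSpace ℝ (Fin n)) y (Y y)) x →
    ∀ u : TangentSpace (𝓡 n) x, D (A.app Y) x u - A x (D Y x u) = 0

end Defs

end KahlerQS

end

set_option linter.unusedSectionVars false
set_option linter.unusedVariables false

namespace KahlerQS

open Filter Topology VectorField FiberBundle

-- Since the Levi-Civita connection `∇` is torsion-free, the two connections are `∇¹_X Y = ∇_X Y -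
-- η(X)AY` and `∇²_X Y = ∇_X Y - η(Y)AX`. Because `∇A = 0` and `A² = -1`, each of `R¹`, `R³`, `R⁵`
-- is `R^g` plus an algebraic expression in `∇η`, `η` and `A` (`curv1_qs`, `curv3_qs`, `curv5_qs`).
-- Their traces follow from three facts: `Tr A = 0`, `Tr R^g(X,Y) = 0`, and a rank-one map `φ ⊗ v`
-- has trace `φ(v)`.
--
-- In `H⁵` the generator then drops out. In `Ric⁵ - Ric¹/2 - 'R³(A·,A·)/2` every term in `η` cancels
-- except `(n-1)/2 · η ⊗ η`; divided by `n - 1`, it removes the `X` and `Z` components of the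
-- correction in `R⁵`. The last line of `H⁵` removes the components along `AX`, `AY`, `AZ`. What
-- remains are `R^g` and Ricci terms, put in the stated form by symmetry of `Ric^g`, which comes
-- from the first Bianchi identity and skew-symmetry of `R^g(X,Y)`.
--
-- Local smoothness is used throughout, because the traces insert extensions of tangent vectors that
-- are known to be smooth only near the base point.

local instance finiteDimensional_tangentSpace {n : ℕ} {M : Type*} [TopologicalSpace M]
    [ChartedSpace (EuclideanSpace ℝ (Fin n)) M]
    (x : M) : FiniteDimensional ℝ (TangentSpace (𝓡 n) x) :=
  inferInstanceAs (FiniteDimensional ℝ (EuclideanSpace ℝ (Fin n)))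

theorem finrank_tangentSpace {n : ℕ} {M : Type*} [TopologicalSpace M]
    [ChartedSpace (EuclideanSpace ℝ (Fin n)) M]
    (x : M) : Module.finrank ℝ (TangentSpace (𝓡 n) x) = n :=
  finrank_euclideanSpace_fin (𝕜 := ℝ)

local instance isManifold_minSmoothness_two {n : ℕ} {M : Type*} [TopologicalSpace M]
    [ChartedSpace (EuclideanSpace ℝ (Fin n)) M]
    [IsManifold (𝓡 n) ∞ M] : IsManifold (𝓡 n) (minSmoothness ℝ 2) M :=
  IsManifold.of_le (n := ∞) (by simpa using WithTop.coe_le_coe.2 (le_top : (2 : ℕ∞) ≤ ⊤))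

local instance isManifold_minSmoothness_three {n : ℕ} {M : Type*} [TopologicalSpace M]
    [ChartedSpace (EuclideanSpace ℝ (Fin n)) M]
    [IsManifold (𝓡 n) ∞ M] : IsManifold (𝓡 n) (minSmoothness ℝ 3) M :=
  IsManifold.of_le (n := ∞) (by simpa using WithTop.coe_le_coe.2 (le_top : (3 : ℕ∞) ≤ ⊤))

/-! ### Locally smooth fields and extensions of tangent vectors -/

section Smoothness

variable {n : ℕ} {M : Type*} [TopologicalSpace M] [ChartedSpace (EuclideanSpace ℝ (Fin n)) M]
  [IsManifold (𝓡 n) ∞ M]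

/-- Differentiability of a vector field at a point. -/
noncomputable def DiffAt (X : VF n M) (x : M) : Prop :=
  MDifferentiableAt (𝓡 n) ((𝓡 n).prod 𝓘(ℝ, EuclideanSpace ℝ (Fin n)))
    (fun y => Bundle.TotalSpace.mk' (EuclideanSpace ℝ (Fin n)) y (X y)) x

/-- Smoothness of a vector field at a point. -/
noncomputable def SmoothAt (X : VF n M) (x : M) : Prop :=
  ContMDiffAt (𝓡 n) ((𝓡 n).prod 𝓘(ℝ, EuclideanSpace ℝ (Fin n))) ∞
    (fun y => Bundle.TotalSpace.mk' (EuclideanSpace ℝ (Fin n)) y (X y)) x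

/-- Smoothness of a vector field on a neighbourhood of a point. -/
noncomputable def SmoothNear (X : VF n M) (x : M) : Prop := ∀ᶠ y in 𝓝 x, SmoothAt X y

/-- Smoothness of a function on a neighbourhood of a point. -/
noncomputable def FunSmoothNear (f : M → ℝ) (x : M) : Prop :=
  ∀ᶠ y in 𝓝 x, ContMDiffAt (𝓡 n) 𝓘(ℝ, ℝ) ∞ f y

variable {X Y Z : VF n M} {f g : M → ℝ} {x : M}

theorem SmoothAt.diffAt (h : SmoothAt X x) : DiffAt X x :=
  ContMDiffAt.mdifferentiableAt h (by simp)

theorem SmoothVF.smoothNear (h : SmoothVF X) (x : M) : SmoothNear X x :=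
  Eventually.of_forall fun y => h y

theorem SmoothNear.smoothAt (h : SmoothNear X x) : SmoothAt X x := h.self_of_nhds

theorem SmoothNear.diffAt (h : SmoothNear X x) : DiffAt X x := h.smoothAt.diffAt

theorem FunSmoothNear.mdifferentiableAt (h : FunSmoothNear (n := n) f x) :
    MDifferentiableAt (𝓡 n) 𝓘(ℝ, ℝ) f x :=
  h.self_of_nhds.mdifferentiableAt (by simp)

theorem SmoothNear.congr (h : SmoothNear X x) (e : X =ᶠ[𝓝 x] Y) : SmoothNear Y x := by
  filter_upwards [h, e.eventuallyEq_nhds] with y hy hey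
  exact ContMDiffAt.congr_of_eventuallyEq hy (hey.symm.mono fun z hz => by simp only [hz])

theorem SmoothNear.add (hX : SmoothNear X x) (hY : SmoothNear Y x) : SmoothNear (X + Y) x := by
  filter_upwards [hX, hY] with y h h' using ContMDiffAt.add_section h h'

theorem SmoothNear.sub (hX : SmoothNear X x) (hY : SmoothNear Y x) : SmoothNear (X - Y) x := by
  filter_upwards [hX, hY] with y h h' using ContMDiffAt.sub_section h h'

theorem SmoothNear.smul (hf : FunSmoothNear (n := n) f x) (hX : SmoothNear X x) :
    SmoothNear (f • X) x := by
  filter_upwards [hf, hX] with y h h' using ContMDiffAt.smul_section h h'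

theorem SmoothNear.const_smul (c : ℝ) (hX : SmoothNear X x) : SmoothNear (c • X) x := by
  filter_upwards [hX] with y h using ContMDiffAt.const_smul_section h

theorem SmoothNear.mlieBracket (hX : SmoothNear X x) (hY : SmoothNear Y x) :
    SmoothNear (mlieBracket (𝓡 n) X Y) x := by
  filter_upwards [hX, hY] with y h h'
  have : IsManifold (𝓡 n) (((⊤ : ℕ∞) : WithTop ℕ∞) + 1) M := by simpa
  exact ContMDiffAt.mlieBracket_vectorField (m := ⊤) (n := ⊤) h h' (by simp)

theorem smoothNear_extend (u : TangentSpace (𝓡 n) x) :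
    SmoothNear (extend (EuclideanSpace ℝ (Fin n)) u) x := by
  obtain ⟨s, hs, h⟩ := exists_contMDiffOn_extend (k := ∞) (𝓡 n) (EuclideanSpace ℝ (Fin n)) u
  filter_upwards [eventually_mem_nhds_iff.2 hs] with y hy using h.contMDiffAt hy

/-- The extension is constant in a local trivialization, so it is linear in the vector on the base
set, hence as a germ. This gives linearity of `u ↦ R(X,Y)u` without a proof that `R` is tensorial in
its last slot. -/
theorem extend_add (u v : TangentSpace (𝓡 n) x) :
    (extend (EuclideanSpace ℝ (Fin n)) (u + v) : VF n M)
      =ᶠ[𝓝 x] extend (EuclideanSpace ℝ (Fin n)) u + extend (EuclideanSpace ℝ (Fin n)) v := by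
  set t := trivializationAt (EuclideanSpace ℝ (Fin n)) (TangentSpace (𝓡 n) : M → Type _) x with ht
  have hx : x ∈ t.baseSet := mem_baseSet_trivializationAt' x
  filter_upwards [t.open_baseSet.mem_nhds hx] with y hy
  simp only [extend, ← ht, Pi.add_apply, ← t.symmL_apply (R := ℝ) hy, ← map_add]
  congr 1
  exact (t.linear ℝ hx).map_add u v

theorem extend_smul (c : ℝ) (u : TangentSpace (𝓡 n) x) :
    (extend (EuclideanSpace ℝ (Fin n)) (c • u) : VF n M)
      =ᶠ[𝓝 x] c • extend (EuclideanSpace ℝ (Fin n)) u := by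
  set t := trivializationAt (EuclideanSpace ℝ (Fin n)) (TangentSpace (𝓡 n) : M → Type _) x with ht
  have hx : x ∈ t.baseSet := mem_baseSet_trivializationAt' x
  filter_upwards [t.open_baseSet.mem_nhds hx] with y hy
  simp only [extend, ← ht, Pi.smul_apply, ← t.symmL_apply (R := ℝ) hy, ← map_smul]
  congr 1
  exact (t.linear ℝ hx).map_smul c u

theorem SmoothEnd.smoothNear_app {A : EndField n M} (hA : SmoothEnd A) (hX : SmoothNear X x) :
    SmoothNear (A.app X) x := by
  filter_upwards [hX] with y h
  exact ContMDiffAt.clm_bundle_apply (hA y) h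

/-- The function `η(X)`. -/
noncomputable def CovectorField.app (η : CovectorField n M) (X : VF n M) : M → ℝ := fun y => η y (X y)

theorem SmoothForm.contMDiffAt_app {η : CovectorField n M} (hη : SmoothForm η)
    (hX : SmoothAt X x) : ContMDiffAt (𝓡 n) 𝓘(ℝ, ℝ) ∞ (η.app X) x := by
  have h : ContMDiffAt (𝓡 n) ((𝓡 n).prod 𝓘(ℝ, ℝ)) ∞
      (fun y => Bundle.TotalSpace.mk' ℝ (E := Bundle.Trivial M ℝ) y (η y (X y))) x :=
    ContMDiffAt.clm_bundle_apply (hη x) hX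
  exact ((Bundle.contMDiffAt_section x).1 h)

theorem SmoothForm.funSmoothNear_app {η : CovectorField n M} (hη : SmoothForm η)
    (hX : SmoothNear X x) : FunSmoothNear (n := n) (η.app X) x := by
  filter_upwards [hX] with y h using hη.contMDiffAt_app h

theorem SmoothForm.mdifferentiableAt_app {η : CovectorField n M} (hη : SmoothForm η)
    (hX : DiffAt X x) : MDifferentiableAt (𝓡 n) 𝓘(ℝ, ℝ) (η.app X) x := by
  have h : MDifferentiableAt (𝓡 n) ((𝓡 n).prod 𝓘(ℝ, ℝ))
      (fun y => Bundle.TotalSpace.mk' ℝ (E := Bundle.Trivial M ℝ) y (η y (X y))) x :=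
    MDifferentiableAt.clm_bundle_apply ((hη x).mdifferentiableAt (by simp)) hX
  exact ((mdifferentiableAt_section (𝓡 n) _).1 h)

/-- A vector field that is smooth near a point agrees there with a smooth vector field. -/
theorem SmoothNear.exists_smoothVF [T2Space M] (h : SmoothNear X x) :
    ∃ X' : VF n M, SmoothVF X' ∧ X' =ᶠ[𝓝 x] X := by
  -- A bump function whose closed support lies where `X` is smooth; `ψX` extended by zero is then
  -- smooth everywhere.
  obtain ⟨ψ, hψ, -⟩ := (SmoothBumpFunction.nhds_basis_support (I := 𝓡 n) h).mem_iff.1 univ_mem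
  refine ⟨(ψ : M → ℝ) • X, fun y => ?_, ?_⟩
  · by_cases hy : y ∈ tsupport ψ
    · exact ContMDiffAt.smul_section ψ.contMDiffAt (hψ hy)
    · have h0 : ContMDiffAt (𝓡 n) ((𝓡 n).prod 𝓘(ℝ, EuclideanSpace ℝ (Fin n))) ∞
          (fun y => Bundle.TotalSpace.mk' (EuclideanSpace ℝ (Fin n)) y
            ((0 : VF n M) y)) y := Bundle.contMDiffAt_zeroSection ℝ _
      refine h0.congr_of_eventuallyEq ?_
      filter_upwards [(isClosed_tsupport ψ).isOpen_compl.mem_nhds hy] with z hz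
      have : ψ z = 0 := image_eq_zero_of_notMem_tsupport hz
      simp [this]
  · filter_upwards [ψ.eventuallyEq_one] with y hy
    simp only [Pi.smul_apply', hy, Pi.one_apply, one_smul]
    rfl

end Smoothness

/-! ### Calculus of a covariant derivative and commutators of derivations -/

section Connection

variable {n : ℕ} {M : Type*} [TopologicalSpace M] [ChartedSpace (EuclideanSpace ℝ (Fin n)) M]
  [IsManifold (𝓡 n) ∞ M] {D : AffineConnection n M} {X X' Y Y' Z : VF n M} {f : M → ℝ} {x : M}

theorem nabla1_congr (hY : DiffAt Y x) (hY' : DiffAt Y' x) (hX : X x = X' x) (e : Y =ᶠ[𝓝 x] Y') :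
    nabla1 D X Y x = nabla1 D X' Y' x := by
  simp only [nabla1, hX]
  rw [D.isCovariantDerivativeOnUniv.congr_of_eventuallyEq hY hY' univ_mem e]

theorem nabla1_add_right (hY : DiffAt Y x) (hY' : DiffAt Y' x) :
    nabla1 D X (Y + Y') x = nabla1 D X Y x + nabla1 D X Y' x := by
  simp only [nabla1]
  rw [D.isCovariantDerivativeOn.add hY hY']
  rfl

theorem nabla1_smul_right (hf : MDifferentiableAt (𝓡 n) 𝓘(ℝ, ℝ) f x) (hY : DiffAt Y x) :
    nabla1 D X (f • Y) x = f x • nabla1 D X Y x + mvfderiv (𝓡 n) f x (X x) • Y x := by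
  simp only [nabla1]
  rw [D.isCovariantDerivativeOn.leibniz hY hf]
  rfl

theorem nabla1_const_smul_right (c : ℝ) (hY : DiffAt Y x) :
    nabla1 D X (c • Y) x = c • nabla1 D X Y x := by
  simp only [nabla1]
  rw [D.isCovariantDerivativeOn.smul_const c hY]
  rfl

theorem DiffAt.sub (hX : DiffAt X x) (hY : DiffAt Y x) : DiffAt (X - Y) x :=
  mdifferentiableAt_sub_section hX hY

theorem DiffAt.smul (hf : MDifferentiableAt (𝓡 n) 𝓘(ℝ, ℝ) f x) (hY : DiffAt Y x) :
    DiffAt (f • Y) x :=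
  MDifferentiableAt.smul_section hf hY

theorem nabla1_sub_right (hY : DiffAt Y x) (hY' : DiffAt Y' x) :
    nabla1 D X (Y - Y') x = nabla1 D X Y x - nabla1 D X Y' x := by
  rw [eq_sub_iff_add_eq, ← nabla1_add_right (hY.sub hY') hY', sub_add_cancel]

theorem nabla1_sub_smul_right {V W : VF n M} (hW : DiffAt W x)
    (hf : MDifferentiableAt (𝓡 n) 𝓘(ℝ, ℝ) f x) (hV : DiffAt V x) :
    nabla1 D X (W - f • V) x
      = nabla1 D X W x - f x • nabla1 D X V x - mvfderiv (𝓡 n) f x (X x) • V x := by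
  rw [nabla1_sub_right hW (hV.smul hf), nabla1_smul_right hf hV, sub_sub]

theorem nabla1_add_left : nabla1 D (X + X') Y = nabla1 D X Y + nabla1 D X' Y := by
  ext1 y
  exact map_add (D Y y) (X y) (X' y)

theorem nabla1_sub_left : nabla1 D (X - X') Y = nabla1 D X Y - nabla1 D X' Y := by
  ext1 y
  exact map_sub (D Y y) (X y) (X' y)

theorem nabla1_smul_left (g : M → ℝ) : nabla1 D (g • X) Y = g • nabla1 D X Y := by
  ext1 y
  exact map_smul (D Y y) (g y) (X y)

theorem nabla1_sub_nabla1 (hT : D.torsion = 0) (hX : DiffAt X x) (hY : DiffAt Y x) :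
    nabla1 D X Y x - nabla1 D Y X x = mlieBracket (𝓡 n) X Y x :=
  D.torsion_eq_zero_iff.1 hT hX hY

/-- Smoothness of `D` is a statement about globally smooth sections, so `Y` is first replaced by a
global field with the same germ; locality of `D` transfers the result back. -/
theorem SmoothNear.cov [T2Space M] (hD : CovariantDerivative.ContMDiffCovariantDerivative D ∞)
    (hY : SmoothNear Y x) :
    ∀ᶠ y in 𝓝 x, ContMDiffAt (𝓡 n)
      ((𝓡 n).prod 𝓘(ℝ, EuclideanSpace ℝ (Fin n) →L[ℝ] EuclideanSpace ℝ (Fin n))) ∞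
      (fun x => Bundle.TotalSpace.mk' (EuclideanSpace ℝ (Fin n) →L[ℝ] EuclideanSpace ℝ (Fin n))
        (E := fun x : M => TangentSpace (𝓡 n) x →L[ℝ] TangentSpace (𝓡 n) x) x (D Y x)) y := by
  obtain ⟨Y', hY', e⟩ := hY.exists_smoothVF
  unfold SmoothVF at hY'
  have h := hD.contMDiff.contMDiff (σ := Y') (ContMDiff.contMDiffOn (by simpa using hY'))
  have e' : ∀ᶠ y in 𝓝 x, D Y' y = D Y y := by
    filter_upwards [hY, e.eventuallyEq_nhds] with y hy he
    exact D.isCovariantDerivativeOnUniv.congr_of_eventuallyEq (SmoothVF.smoothNear hY' y).diffAt hy.diffAt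
      univ_mem he
  filter_upwards [eventually_eventually_nhds.2 e'] with y hy
  refine ContMDiffAt.congr_of_eventuallyEq (h.contMDiffAt univ_mem) ?_
  filter_upwards [hy] with z hz
  rw [hz]

theorem SmoothNear.nabla1 [T2Space M] (hD : CovariantDerivative.ContMDiffCovariantDerivative D ∞)
    (hX : SmoothNear X x) (hY : SmoothNear Y x) : SmoothNear (nabla1 D X Y) x := by
  filter_upwards [hX, hY.cov hD] with y h h'
  exact ContMDiffAt.clm_bundle_apply h' h

/-- Only differentiability of `X` is required, since tensoriality in `X` is tested on fields that
are merely differentiable at the point. -/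
theorem DiffAt.nabla1 [T2Space M] (hD : CovariantDerivative.ContMDiffCovariantDerivative D ∞)
    (hX : DiffAt X x) (hY : SmoothNear Y x) : DiffAt (nabla1 D X Y) x :=
  MDifferentiableAt.clm_bundle_apply
    ((hY.cov hD).self_of_nhds.mdifferentiableAt (by simp)) hX

/-- The commutator of derivations along vector fields is the derivation along the bracket. -/
theorem mvfderiv_mvfderiv_sub (hX : SmoothNear X x) (hY : SmoothNear Y x)
    (hf : FunSmoothNear (n := n) f x)
    (hXf : MDifferentiableAt (𝓡 n) 𝓘(ℝ, ℝ) (fun y => mvfderiv (𝓡 n) f y (X y)) x)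
    (hYf : MDifferentiableAt (𝓡 n) 𝓘(ℝ, ℝ) (fun y => mvfderiv (𝓡 n) f y (Y y)) x) :
    mvfderiv (𝓡 n) (fun y => mvfderiv (𝓡 n) f y (Y y)) x (X x)
        - mvfderiv (𝓡 n) (fun y => mvfderiv (𝓡 n) f y (X y)) x (Y x)
      = mvfderiv (𝓡 n) f x (mlieBracket (𝓡 n) X Y x) := by
  -- The identity is read off as the coefficient of a nonzero tangent vector, so the
  -- zero-dimensional case is separate.
  rcases subsingleton_or_nontrivial (TangentSpace (𝓡 n) x) with h | h
  · simp [Subsingleton.elim (X x) 0, Subsingleton.elim (Y x) 0,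
      Subsingleton.elim (mlieBracket (𝓡 n) X Y x) 0]
  obtain ⟨u, hu⟩ := exists_ne (0 : TangentSpace (𝓡 n) x)
  have key (Z : VF n M) (hZ : SmoothNear Z x) :
      (mvfderiv (𝓡 n) (fun y => mvfderiv (𝓡 n) f y (Y y)) x (X x)
        - mvfderiv (𝓡 n) (fun y => mvfderiv (𝓡 n) f y (X y)) x (Y x)) • Z x
      = mvfderiv (𝓡 n) f x (mlieBracket (𝓡 n) X Y x) • Z x := by
    have two {W : VF n M} (hW : SmoothNear W x) : ContMDiffAt (𝓡 n)
        ((𝓡 n).prod 𝓘(ℝ, EuclideanSpace ℝ (Fin n))) (minSmoothness ℝ 2)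
        (fun y => Bundle.TotalSpace.mk' (EuclideanSpace ℝ (Fin n)) y (W y)) x :=
      ContMDiffAt.of_le hW.smoothAt (by simpa using WithTop.coe_le_coe.2 (le_top : (2 : ℕ∞) ≤ ⊤))
    have ev (W : VF n M) : mlieBracket (𝓡 n) W (f • Z) =ᶠ[𝓝 x]
        (fun y => mvfderiv (𝓡 n) f y (W y)) • Z + f • mlieBracket (𝓡 n) W Z := by
      filter_upwards [hZ, hf] with y hZ hf
      exact mlieBracket_smul_right (hf.mdifferentiableAt (by simp)) hZ.diffAt
    have br (V W : VF n M) (hW : SmoothNear W x)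
        (hWf : MDifferentiableAt (𝓡 n) 𝓘(ℝ, ℝ) (fun y => mvfderiv (𝓡 n) f y (W y)) x) :
        mlieBracket (𝓡 n) V (mlieBracket (𝓡 n) W (f • Z)) x
        = mvfderiv (𝓡 n) (fun y => mvfderiv (𝓡 n) f y (W y)) x (V x) • Z x
          + mvfderiv (𝓡 n) f x (W x) • mlieBracket (𝓡 n) V Z x
          + (mvfderiv (𝓡 n) f x (V x) • mlieBracket (𝓡 n) W Z x
          + f x • mlieBracket (𝓡 n) V (mlieBracket (𝓡 n) W Z) x) := by
      rw [EventuallyEq.rfl.mlieBracket_vectorField_eq (ev W),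
        mlieBracket_add_right (hZ.diffAt.smul hWf)
          ((hW.mlieBracket hZ).diffAt.smul hf.mdifferentiableAt),
        mlieBracket_smul_right hWf hZ.diffAt,
        mlieBracket_smul_right hf.mdifferentiableAt (hW.mlieBracket hZ).diffAt]
    -- The Jacobi identity for `X, Y, fZ` minus `f` times the one for `X, Y, Z` leaves exactly the
    -- commutator of derivatives of `f`, times `Z`.
    have J1 := leibniz_identity_mlieBracket_apply (two hX) (two hY) (two (hZ.smul hf))
    have J2 := leibniz_identity_mlieBracket_apply (two hX) (two hY) (two hZ)
    rw [br X Y hY hYf, br Y X hX hXf,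
      mlieBracket_smul_right hf.mdifferentiableAt hZ.diffAt, J2] at J1
    rw [sub_smul, sub_eq_iff_eq_add]
    have := sub_eq_zero.2 J1
    rw [← sub_eq_zero, ← this]
    module
  have h := key (extend (EuclideanSpace ℝ (Fin n)) u) (smoothNear_extend u)
  rw [extend_apply_self] at h
  exact smul_left_injective ℝ hu h

end Connection

/-! ### Curvature and Ricci tensor of the Levi-Civita connection -/

section Curvature

variable {n : ℕ} {M : Type*} [TopologicalSpace M] [ChartedSpace (EuclideanSpace ℝ (Fin n)) M]
  [IsManifold (𝓡 n) ∞ M] {D : AffineConnection n M} {X X' Y Y' Z Z' : VF n M} {f : M → ℝ} {x : M}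

theorem curv1_apply : curv1 D X Y Z x = nabla1 D X (nabla1 D Y Z) x - nabla1 D Y (nabla1 D X Z) x
    - nabla1 D (mlieBracket (𝓡 n) X Y) Z x := rfl

theorem curv1_swap : curv1 D X Y Z x = -curv1 D Y X Z x := by
  have h : nabla1 D (mlieBracket (𝓡 n) X Y) Z x = -nabla1 D (mlieBracket (𝓡 n) Y X) Z x := by
    rw [mlieBracket_swap]
    exact map_neg (D Z x) _
  rw [curv1_apply, curv1_apply, h]
  abel

theorem nabla1_eventuallyEq (hZ : SmoothNear Z x) (e : Z =ᶠ[𝓝 x] Z') :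
    nabla1 D X Z =ᶠ[𝓝 x] nabla1 D X Z' := by
  filter_upwards [hZ, hZ.congr e, e.eventuallyEq_nhds] with y h h' he
  exact nabla1_congr h.diffAt h'.diffAt rfl he

theorem curv1_congr_right [T2Space M]
    (hD : CovariantDerivative.ContMDiffCovariantDerivative D ∞)
    (hX : SmoothNear X x) (hY : SmoothNear Y x) (hZ : SmoothNear Z x) (e : Z =ᶠ[𝓝 x] Z') :
    curv1 D X Y Z x = curv1 D X Y Z' x := by
  have hZ' := hZ.congr e
  rw [curv1_apply, curv1_apply,
    nabla1_congr (hY.nabla1 hD hZ).diffAt (hY.nabla1 hD hZ').diffAt rfl (nabla1_eventuallyEq hZ e),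
    nabla1_congr (hX.nabla1 hD hZ).diffAt (hX.nabla1 hD hZ').diffAt rfl (nabla1_eventuallyEq hZ e),
    nabla1_congr hZ.diffAt hZ'.diffAt rfl e]

theorem curv1_add_right [T2Space M] (hD : CovariantDerivative.ContMDiffCovariantDerivative D ∞)
    (hX : SmoothNear X x) (hY : SmoothNear Y x) (hZ : SmoothNear Z x) (hZ' : SmoothNear Z' x) :
    curv1 D X Y (Z + Z') x = curv1 D X Y Z x + curv1 D X Y Z' x := by
  have key {V W : VF n M} (hW : SmoothNear W x) :
      nabla1 D V (nabla1 D W (Z + Z')) x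
        = nabla1 D V (nabla1 D W Z) x + nabla1 D V (nabla1 D W Z') x := by
    rw [← nabla1_add_right (hW.nabla1 hD hZ).diffAt (hW.nabla1 hD hZ').diffAt]
    refine nabla1_congr (hW.nabla1 hD (hZ.add hZ')).diffAt
      ((hW.nabla1 hD hZ).add (hW.nabla1 hD hZ')).diffAt rfl ?_
    filter_upwards [hZ, hZ'] with y h h' using nabla1_add_right h.diffAt h'.diffAt
  rw [curv1_apply, curv1_apply, curv1_apply, key hY, key hX,
    nabla1_add_right hZ.diffAt hZ'.diffAt]
  abel

theorem curv1_const_smul_right [T2Space M]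
    (hD : CovariantDerivative.ContMDiffCovariantDerivative D ∞)
    (hX : SmoothNear X x) (hY : SmoothNear Y x) (hZ : SmoothNear Z x) (c : ℝ) :
    curv1 D X Y (c • Z) x = c • curv1 D X Y Z x := by
  have key {V W : VF n M} (hW : SmoothNear W x) :
      nabla1 D V (nabla1 D W (c • Z)) x = c • nabla1 D V (nabla1 D W Z) x := by
    rw [← nabla1_const_smul_right c (hW.nabla1 hD hZ).diffAt]
    refine nabla1_congr (hW.nabla1 hD (hZ.const_smul c)).diffAt
      ((hW.nabla1 hD hZ).const_smul c).diffAt rfl ?_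
    filter_upwards [hZ] with y h using nabla1_const_smul_right c h.diffAt
  rw [curv1_apply, curv1_apply, key hY, key hX, nabla1_const_smul_right c hZ.diffAt]
  module

/-- The endomorphism `u ↦ R(X,Y)u` of the tangent space at `x`. -/
noncomputable def curvEnd [T2Space M]
    (hD : CovariantDerivative.ContMDiffCovariantDerivative D ∞)
    (hX : SmoothNear X x) (hY : SmoothNear Y x) :
    TangentSpace (𝓡 n) x →ₗ[ℝ] TangentSpace (𝓡 n) x where
  toFun u := curv1 D X Y (extend (EuclideanSpace ℝ (Fin n)) u) x
  map_add' u v := by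
    rw [curv1_congr_right hD hX hY (smoothNear_extend _) (extend_add u v),
      curv1_add_right hD hX hY (smoothNear_extend _) (smoothNear_extend _)]
  map_smul' c u := by
    rw [curv1_congr_right hD hX hY (smoothNear_extend _) (extend_smul c u),
      curv1_const_smul_right hD hX hY (smoothNear_extend _), RingHom.id_apply]

/-- The term `(Yf)∇_X Z` produced by `∇_Y(f∇_X Z)` is cancelled by the one coming from `[fX, Y]`. -/
theorem tensorialAt_curv1 [T2Space M]
    (hD : CovariantDerivative.ContMDiffCovariantDerivative D ∞)
    (hY : SmoothNear Y x) (hZ : SmoothNear Z x) :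
    TensorialAt (𝓡 n) (EuclideanSpace ℝ (Fin n)) (fun X : VF n M => curv1 D X Y Z x) x where
  smul {f X} hf hX := by
    have h : nabla1 D (mlieBracket (𝓡 n) (f • X) Y) Z x
        = -mvfderiv (𝓡 n) f x (Y x) • nabla1 D X Z x
          + f x • nabla1 D (mlieBracket (𝓡 n) X Y) Z x := by
      simp only [nabla1]
      rw [mlieBracket_smul_left hf hX, map_add, map_smul, map_smul]
    rw [curv1_apply, curv1_apply, h, nabla1_smul_left, nabla1_smul_left,
      nabla1_smul_right hf (DiffAt.nabla1 hD hX hZ), Pi.smul_apply']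
    module
  add {X X'} hX hX' := by
    have h : nabla1 D (mlieBracket (𝓡 n) (X + X') Y) Z x
        = nabla1 D (mlieBracket (𝓡 n) X Y) Z x + nabla1 D (mlieBracket (𝓡 n) X' Y) Z x := by
      simp only [nabla1]
      rw [mlieBracket_add_left hX hX', map_add]
    rw [curv1_apply, curv1_apply, curv1_apply, h, nabla1_add_left, nabla1_add_left,
      nabla1_add_right (DiffAt.nabla1 hD hX hZ) (DiffAt.nabla1 hD hX' hZ), Pi.add_apply]
    abel

/-- The endomorphism `u ↦ R(u,Y)Z` of the tangent space at `x`. -/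
noncomputable def ricEnd [T2Space M] (hD : CovariantDerivative.ContMDiffCovariantDerivative D ∞)
    (hY : SmoothNear Y x) (hZ : SmoothNear Z x) :
    TangentSpace (𝓡 n) x →ₗ[ℝ] TangentSpace (𝓡 n) x :=
  TensorialAt.mkHom (fun X : VF n M => curv1 D X Y Z x) x (tensorialAt_curv1 hD hY hZ)

theorem ricEnd_apply [T2Space M] (hD : CovariantDerivative.ContMDiffCovariantDerivative D ∞)
    (hY : SmoothNear Y x) (hZ : SmoothNear Z x) (u : TangentSpace (𝓡 n) x) :
    ricEnd hD hY hZ u = curv1 D (extend (EuclideanSpace ℝ (Fin n)) u) Y Z x := rfl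

theorem curvEnd_apply [T2Space M] (hD : CovariantDerivative.ContMDiffCovariantDerivative D ∞)
    (hX : SmoothNear X x) (hY : SmoothNear Y x) (u : TangentSpace (𝓡 n) x) :
    curvEnd hD hX hY u = curv1 D X Y (extend (EuclideanSpace ℝ (Fin n)) u) x := rfl

theorem mvfderiv_congr {f g : M → ℝ} (e : f =ᶠ[𝓝 x] g) :
    mvfderiv (𝓡 n) f x = mvfderiv (𝓡 n) g x :=
  e.mfderiv_eq

/-- Every trace is computed by exhibiting a linear map that agrees with the bare function, which
rules out the junk value. -/
theorem traceAt_eq {φ : TangentSpace (𝓡 n) x → TangentSpace (𝓡 n) x}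
    (L : TangentSpace (𝓡 n) x →ₗ[ℝ] TangentSpace (𝓡 n) x) (h : ∀ u, φ u = L u) :
    traceAt x φ = LinearMap.trace ℝ (TangentSpace (𝓡 n) x) L := by
  obtain rfl : φ = L := funext h
  rw [traceAt, dif_pos L.isLinear]
  rfl

/-- Torsion-freeness, applied twice, groups the nine terms into nested brackets `[U,[V,W]]`, whose
cyclic sum vanishes by Jacobi. -/
theorem bianchi [T2Space M] (hD : CovariantDerivative.ContMDiffCovariantDerivative D ∞)
    (hT : D.torsion = 0) (hX : SmoothNear X x) (hY : SmoothNear Y x) (hZ : SmoothNear Z x) :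
    curv1 D X Y Z x + curv1 D Y Z X x + curv1 D Z X Y x = 0 := by
  have two {W : VF n M} (hW : SmoothNear W x) : ContMDiffAt (𝓡 n)
      ((𝓡 n).prod 𝓘(ℝ, EuclideanSpace ℝ (Fin n))) (minSmoothness ℝ 2)
      (fun y => Bundle.TotalSpace.mk' (EuclideanSpace ℝ (Fin n)) y (W y)) x :=
    ContMDiffAt.of_le hW.smoothAt (by simpa using WithTop.coe_le_coe.2 (le_top : (2 : ℕ∞) ≤ ⊤))
  have key {U V W : VF n M} (hU : SmoothNear U x) (hV : SmoothNear V x) (hW : SmoothNear W x) :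
      nabla1 D U (nabla1 D V W) x - nabla1 D U (nabla1 D W V) x
        - nabla1 D (mlieBracket (𝓡 n) V W) U x
        = mlieBracket (𝓡 n) U (mlieBracket (𝓡 n) V W) x := by
    rw [← nabla1_sub_right (hV.nabla1 hD hW).diffAt (hW.nabla1 hD hV).diffAt,
      ← nabla1_sub_nabla1 hT hU.diffAt (hV.mlieBracket hW).diffAt]
    congr 1
    refine nabla1_congr ((hV.nabla1 hD hW).sub (hW.nabla1 hD hV)).diffAt
      (hV.mlieBracket hW).diffAt rfl ?_
    filter_upwards [hV, hW] with y h h' using nabla1_sub_nabla1 hT h.diffAt h'.diffAt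
  have J := leibniz_identity_mlieBracket_apply (two hX) (two hY) (two hZ)
  have s1 : mlieBracket (𝓡 n) (mlieBracket (𝓡 n) X Y) Z x
      = -mlieBracket (𝓡 n) Z (mlieBracket (𝓡 n) X Y) x := by
    rw [mlieBracket_swap]; rfl
  have s2 : mlieBracket (𝓡 n) Y (mlieBracket (𝓡 n) X Z) x
      = -mlieBracket (𝓡 n) Y (mlieBracket (𝓡 n) Z X) x := by
    rw [mlieBracket_swap (V := X), ← neg_one_smul ℝ (mlieBracket (𝓡 n) Z X),
      mlieBracket_const_smul_right (hZ.mlieBracket hX).diffAt, neg_one_smul]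
  rw [s1, s2, ← key hX hY hZ, ← key hZ hX hY, ← key hY hZ hX] at J
  rw [curv1_apply, curv1_apply, curv1_apply]
  rw [← sub_eq_zero] at J
  rw [← J]
  abel

variable [Bundle.RiemannianBundle (fun x : M => TangentSpace (𝓡 n) x)]
  [IsContMDiffRiemannianBundle (𝓡 n) ∞ (EuclideanSpace ℝ (Fin n))
    (fun x : M => TangentSpace (𝓡 n) x)]

theorem trace_eq_zero_of_inner_self
    (L : TangentSpace (𝓡 n) x →ₗ[ℝ] TangentSpace (𝓡 n) x) (h : ∀ u, inner ℝ (L u) u = 0) :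
    LinearMap.trace ℝ (TangentSpace (𝓡 n) x) L = 0 := by
  rw [LinearMap.trace_eq_sum_inner L (stdOrthonormalBasis ℝ (TangentSpace (𝓡 n) x))]
  exact Finset.sum_eq_zero fun i _ => by rw [real_inner_comm, h]

theorem SmoothNear.inner (hX : SmoothNear X x) (hY : SmoothNear Y x) :
    FunSmoothNear (n := n) (fun y => inner ℝ (X y) (Y y)) x := by
  filter_upwards [hX, hY] with y h h' using ContMDiffAt.inner_bundle h h'

/-- Differentiate `|Z|²` along `X` and `Y` in both orders: the cross term `⟨∇_X Z, ∇_Y Z⟩` is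
symmetric, and the commutator of derivations accounts for the bracket term. -/
theorem inner_curv1_self [T2Space M] (hD : IsLeviCivita D)
    (hX : SmoothNear X x) (hY : SmoothNear Y x) (hZ : SmoothNear Z x) :
    inner ℝ (curv1 D X Y Z x) (Z x) = 0 := by
  have d (U : VF n M) {V W : VF n M} {y : M} (hV : DiffAt V y) (hW : DiffAt W y) :
      mvfderiv (𝓡 n) (fun y => inner ℝ (V y) (W y)) y (U y)
        = inner ℝ (nabla1 D U V y) (W y) + inner ℝ (V y) (nabla1 D U W y) :=
    hD.metric.mvfderiv_inner_eq U hV hW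
  have d1 (U : VF n M) : (fun y => mvfderiv (𝓡 n) (fun y => inner ℝ (Z y) (Z y)) y (U y))
      =ᶠ[𝓝 x] (fun y => 2 * inner ℝ (nabla1 D U Z y) (Z y)) := by
    filter_upwards [hZ] with y h
    rw [d U h.diffAt h.diffAt, real_inner_comm (nabla1 D U Z y), two_mul]
  have m {U : VF n M} (hU : SmoothNear U x) : MDifferentiableAt (𝓡 n) 𝓘(ℝ, ℝ)
      (fun y => inner ℝ (nabla1 D U Z y) (Z y)) x :=
    ((hU.nabla1 hD.smooth hZ).inner hZ).mdifferentiableAt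
  have m2 {U : VF n M} (hU : SmoothNear U x) : MDifferentiableAt (𝓡 n) 𝓘(ℝ, ℝ)
      (fun y => mvfderiv (𝓡 n) (fun y => inner ℝ (Z y) (Z y)) y (U y)) x :=
    (mdifferentiableAt_const.mul (m hU)).congr_of_eventuallyEq (d1 U)
  have d2 {U V : VF n M} (hU : SmoothNear U x) :
      mvfderiv (𝓡 n) (fun y => mvfderiv (𝓡 n) (fun y => inner ℝ (Z y) (Z y)) y (U y)) x (V x)
        = 2 * (inner ℝ (nabla1 D V (nabla1 D U Z) x) (Z x)
            + inner ℝ (nabla1 D U Z x) (nabla1 D V Z x)) := by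
    rw [← d V (hU.nabla1 hD.smooth hZ).diffAt hZ.diffAt]
    rw [mvfderiv_congr (d1 U), mvfderiv_fun_mul mdifferentiableAt_const (m hU), mvfderiv_const]
    simp
  have h := mvfderiv_mvfderiv_sub hX hY (hZ.inner hZ) (m2 hX) (m2 hY)
  rw [d2 hX, d2 hY, d (mlieBracket (𝓡 n) X Y) hZ.diffAt hZ.diffAt,
    real_inner_comm (nabla1 D (mlieBracket (𝓡 n) X Y) Z x),
    real_inner_comm (nabla1 D X Z x) (nabla1 D Y Z x)] at h
  rw [curv1_apply, inner_sub_left, inner_sub_left]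
  linarith

theorem trace_curvEnd [T2Space M] (hD : IsLeviCivita D)
    (hX : SmoothNear X x) (hY : SmoothNear Y x) :
    LinearMap.trace ℝ _ (curvEnd hD.smooth hX hY) = 0 := by
  refine trace_eq_zero_of_inner_self _ fun u => ?_
  have h := inner_curv1_self hD hX hY (smoothNear_extend u)
  rwa [extend_apply_self] at h

/-- By Bianchi, `R(u,Y)Z - R(u,Z)Y = -R(Y,Z)u`, and the right side is traceless in `u`. -/
theorem trace_ricEnd_comm [T2Space M] (hD : IsLeviCivita D)
    (hY : SmoothNear Y x) (hZ : SmoothNear Z x) :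
    LinearMap.trace ℝ _ (ricEnd hD.smooth hY hZ) = LinearMap.trace ℝ _ (ricEnd hD.smooth hZ hY) := by
  have h : ricEnd hD.smooth hY hZ - ricEnd hD.smooth hZ hY = -curvEnd hD.smooth hY hZ := by
    ext1 u
    have hb := bianchi hD.smooth hD.torsion_free (smoothNear_extend u) hY hZ
    rw [curv1_swap (X := Z), add_right_comm, add_eq_zero_iff_eq_neg] at hb
    rw [LinearMap.sub_apply, LinearMap.neg_apply, ricEnd_apply, ricEnd_apply, curvEnd_apply, ← hb,
      sub_eq_add_neg]
  rw [← sub_eq_zero, ← map_sub, h, map_neg, trace_curvEnd hD, neg_zero]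

theorem ric_curv1 [T2Space M] (hD : CovariantDerivative.ContMDiffCovariantDerivative D ∞)
    (hY : SmoothNear Y x) (hZ : SmoothNear Z x) :
    ric (curv1 D) Y Z x = LinearMap.trace ℝ _ (ricEnd hD hY hZ) :=
  traceAt_eq _ fun _ => rfl

theorem ric_curv1_comm [T2Space M] (hD : IsLeviCivita D)
    (hY : SmoothNear Y x) (hZ : SmoothNear Z x) :
    ric (curv1 D) Y Z x = ric (curv1 D) Z Y x := by
  rw [ric_curv1 hD.smooth hY hZ, ric_curv1 hD.smooth hZ hY, trace_ricEnd_comm hD]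

end Curvature

/-! ### Curvatures of the quarter-symmetric connection -/

section QuarterSymmetric

variable {n : ℕ} {M : Type*} [TopologicalSpace M] [ChartedSpace (EuclideanSpace ℝ (Fin n)) M]
  [IsManifold (𝓡 n) ∞ M] {D : AffineConnection n M} {A : EndField n M} {η : CovectorField n M}
  {X X' Y Y' Z Z' : VF n M} {f : M → ℝ} {x : M}

/-- Tensoriality makes `∇η` a bilinear form on the tangent space, so that it can enter traces. -/
theorem tensorialAt_covForm (D : AffineConnection n M) (hη : SmoothForm η) (x : M) :
    TensorialAt (𝓡 n) (EuclideanSpace ℝ (Fin n))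
      (fun Y : VF n M => mvfderiv (𝓡 n) (η.app Y) x - (η x).comp (D Y x)) x where
  smul {f Y} hf hY := by
    have h : η.app (f • Y) = f * η.app Y := funext fun y => map_smul (η y) (f y) (Y y)
    rw [h, mvfderiv_mul hf (hη.mdifferentiableAt_app hY), D.isCovariantDerivativeOn.leibniz hY hf]
    ext u
    simp only [ContinuousLinearMap.comp_apply, sub_apply, add_apply, smul_apply,
      ContinuousLinearMap.smulRight_apply, map_add, map_smul, smul_eq_mul, CovectorField.app]
    ring
  add {Y Y'} hY hY' := by
    have h : η.app (Y + Y') = η.app Y + η.app Y' := funext fun y => map_add (η y) (Y y) (Y' y)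
    rw [h, mvfderiv_add (hη.mdifferentiableAt_app hY) (hη.mdifferentiableAt_app hY'),
      D.isCovariantDerivativeOn.add hY hY']
    ext u
    simp only [ContinuousLinearMap.comp_apply, sub_apply, add_apply, map_add]
    ring

/-- The covariant derivative of a 1-form: `covForm D hη x v u = (∇_u η)(v)`. -/
noncomputable def covForm (D : AffineConnection n M) (hη : SmoothForm η) (x : M) :
    TangentSpace (𝓡 n) x →L[ℝ] TangentSpace (𝓡 n) x →L[ℝ] ℝ :=
  TensorialAt.mkHom _ x (tensorialAt_covForm D hη x)

theorem covForm_apply (hη : SmoothForm η) (hY : DiffAt Y x) (X : VF n M) :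
    covForm D hη x (Y x) (X x) = mvfderiv (𝓡 n) (η.app Y) x (X x) - η x (nabla1 D X Y x) := by
  rw [covForm, TensorialAt.mkHom_apply _ hY]
  rfl

theorem nabla1_qsConnection :
    nabla1 (qsConnection D A η) X Y = nabla1 D X Y - η.app X • A.app Y := rfl

/-- Torsion-freeness absorbs the bracket, so conjugation just moves `η` to the other argument. -/
theorem nabla2_qsConnection (hT : D.torsion = 0) (hX : DiffAt X x) (hY : DiffAt Y x) :
    nabla2 (qsConnection D A η) X Y x = (nabla1 D X Y - η.app Y • A.app X) x := by
  rw [nabla2, nabla1_qsConnection, Pi.add_apply, ← nabla1_sub_nabla1 hT hX hY, Pi.sub_apply,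
    Pi.sub_apply]
  abel

variable [Bundle.RiemannianBundle (fun x : M => TangentSpace (𝓡 n) x)]
  [IsContMDiffRiemannianBundle (𝓡 n) ∞ (EuclideanSpace ℝ (Fin n))
    (fun x : M => TangentSpace (𝓡 n) x)]

theorem SmoothNear.app (hA : IsKahler D A) (hX : SmoothNear X x) : SmoothNear (A.app X) x :=
  hA.smooth.smoothNear_app hX

theorem IsKahler.nabla1_app (hA : IsKahler D A) (hY : DiffAt Y x) :
    nabla1 D X (A.app Y) x = A x (nabla1 D X Y x) :=
  sub_eq_zero.1 (hA.parallel Y x hY (X x))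

theorem app_sub_smul (V W : VF n M) (g : M → ℝ) :
    A.app (W - g • V) x = A x (W x) - g x • A x (V x) := by
  simp [EndField.app]

theorem covector_app_sub_smul (V W : VF n M) (g : M → ℝ) :
    η.app (W - g • V) x = η x (W x) - g x * η x (V x) := by
  simp [CovectorField.app]

/-- `∇_X (∇_Y Z - f AV)` for the Levi-Civita connection of a Kähler manifold. -/
theorem nabla1_nabla1_sub [T2Space M] (hD : IsLeviCivita D) (hA : IsKahler D A)
    {V : VF n M} (hf : FunSmoothNear (n := n) f x) (hY : SmoothNear Y x)
    (hZ : SmoothNear Z x) (hV : SmoothNear V x) :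
    nabla1 D X (nabla1 D Y Z - f • A.app V) x = nabla1 D X (nabla1 D Y Z) x
      - f x • A x (nabla1 D X V x) - mvfderiv (𝓡 n) f x (X x) • A x (V x) := by
  rw [nabla1_sub_smul_right (hY.nabla1 hD.smooth hZ).diffAt hf.mdifferentiableAt
    (hV.app hA).diffAt, hA.nabla1_app hV.diffAt]
  rfl

theorem nabla1_qs_nabla1_qs [T2Space M] (hD : IsLeviCivita D) (hA : IsKahler D A)
    (hη : SmoothForm η) (X : VF n M) (hY : SmoothNear Y x) (hZ : SmoothNear Z x) :
    nabla1 (qsConnection D A η) X (nabla1 (qsConnection D A η) Y Z) x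
      = nabla1 D X (nabla1 D Y Z) x - η x (Y x) • A x (nabla1 D X Z x)
        - mvfderiv (𝓡 n) (η.app Y) x (X x) • A x (Z x)
        - η x (X x) • (A x (nabla1 D Y Z x) + η x (Y x) • Z x) := by
  rw [nabla1_qsConnection, nabla1_qsConnection, Pi.sub_apply, Pi.smul_apply', app_sub_smul,
    nabla1_nabla1_sub hD hA (hη.funSmoothNear_app hY) hY hZ hZ]
  simp only [EndField.app, CovectorField.app, hA.sq]
  module

theorem smoothNear_sub_smul_app [T2Space M] (hD : IsLeviCivita D) (hA : IsKahler D A)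
    {V : VF n M} (hf : FunSmoothNear (n := n) f x) (hY : SmoothNear Y x)
    (hZ : SmoothNear Z x) (hV : SmoothNear V x) :
    SmoothNear (nabla1 D Y Z - f • A.app V) x :=
  (hY.nabla1 hD.smooth hZ).sub ((hV.app hA).smul hf)

theorem nabla2_qs_eventuallyEq (hD : IsLeviCivita D) (hX : SmoothNear X x)
    (hY : SmoothNear Y x) :
    nabla2 (qsConnection D A η) X Y =ᶠ[𝓝 x] nabla1 D X Y - η.app Y • A.app X := by
  filter_upwards [hX, hY] with y h h'
  exact nabla2_qsConnection hD.torsion_free h.diffAt h'.diffAt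

theorem smoothNear_nabla2_qs [T2Space M] (hD : IsLeviCivita D) (hA : IsKahler D A)
    (hη : SmoothForm η) (hX : SmoothNear X x) (hY : SmoothNear Y x) :
    SmoothNear (nabla2 (qsConnection D A η) X Y) x :=
  (smoothNear_sub_smul_app hD hA (hη.funSmoothNear_app hY) hX hY hX).congr
    (nabla2_qs_eventuallyEq hD hX hY).symm

theorem nabla2_qs_nabla1_qs [T2Space M] (hD : IsLeviCivita D) (hA : IsKahler D A)
    (hη : SmoothForm η) (hX : SmoothNear X x) (hY : SmoothNear Y x) (hZ : SmoothNear Z x) :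
    nabla2 (qsConnection D A η) X (nabla1 (qsConnection D A η) Y Z) x
      = nabla1 D X (nabla1 D Y Z) x - η x (Y x) • A x (nabla1 D X Z x)
        - mvfderiv (𝓡 n) (η.app Y) x (X x) • A x (Z x)
        - (η x (nabla1 D Y Z x) - η x (Y x) * η x (A x (Z x))) • A x (X x) := by
  rw [nabla1_qsConnection, nabla2_qsConnection hD.torsion_free hX.diffAt
    (smoothNear_sub_smul_app hD hA (hη.funSmoothNear_app hY) hY hZ hZ).diffAt,
    Pi.sub_apply, Pi.smul_apply', covector_app_sub_smul,
    nabla1_nabla1_sub hD hA (hη.funSmoothNear_app hY) hY hZ hZ]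
  rfl

theorem nabla1_qs_nabla2_qs [T2Space M] (hD : IsLeviCivita D) (hA : IsKahler D A)
    (hη : SmoothForm η) (Y : VF n M) (hX : SmoothNear X x) (hZ : SmoothNear Z x) :
    nabla1 (qsConnection D A η) Y (nabla2 (qsConnection D A η) X Z) x
      = nabla1 D Y (nabla1 D X Z) x - η x (Z x) • A x (nabla1 D Y X x)
        - mvfderiv (𝓡 n) (η.app Z) x (Y x) • A x (X x)
        - η x (Y x) • (A x (nabla1 D X Z x) + η x (Z x) • X x) := by
  rw [nabla1_congr (smoothNear_nabla2_qs hD hA hη hX hZ).diffAt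
    (smoothNear_sub_smul_app hD hA (hη.funSmoothNear_app hZ) hX hZ hX).diffAt rfl
    (nabla2_qs_eventuallyEq hD hX hZ), nabla1_qsConnection, Pi.sub_apply, Pi.smul_apply',
    app_sub_smul, nabla1_nabla1_sub hD hA (hη.funSmoothNear_app hZ) hX hZ hX]
  simp only [EndField.app, CovectorField.app, hA.sq]
  module

theorem nabla2_qs_nabla2_qs [T2Space M] (hD : IsLeviCivita D) (hA : IsKahler D A)
    (hη : SmoothForm η) (hX : SmoothNear X x) (hY : SmoothNear Y x) (hZ : SmoothNear Z x) :
    nabla2 (qsConnection D A η) X (nabla2 (qsConnection D A η) Y Z) x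
      = nabla1 D X (nabla1 D Y Z) x - η x (Z x) • A x (nabla1 D X Y x)
        - mvfderiv (𝓡 n) (η.app Z) x (X x) • A x (Y x)
        - (η x (nabla1 D Y Z x) - η x (Z x) * η x (A x (Y x))) • A x (X x) := by
  have h : η.app (nabla2 (qsConnection D A η) Y Z) x
      = η.app (nabla1 D Y Z - η.app Z • A.app Y) x := by
    simp only [CovectorField.app, nabla2_qsConnection hD.torsion_free hY.diffAt hZ.diffAt]
  rw [nabla2_qsConnection hD.torsion_free hX.diffAt (smoothNear_nabla2_qs hD hA hη hY hZ).diffAt,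
    Pi.sub_apply, Pi.smul_apply', h, covector_app_sub_smul,
    nabla1_congr (smoothNear_nabla2_qs hD hA hη hY hZ).diffAt
    (smoothNear_sub_smul_app hD hA (hη.funSmoothNear_app hZ) hY hZ hY).diffAt rfl
    (nabla2_qs_eventuallyEq hD hY hZ),
    nabla1_nabla1_sub hD hA (hη.funSmoothNear_app hZ) hY hZ hY]
  rfl

/-- The quadratic part `η(X)η(Y)Z` is symmetric in `X, Y` and cancels; only `dη` survives. -/
theorem curv1_qs [T2Space M] (hD : IsLeviCivita D) (hA : IsKahler D A)
    (hη : SmoothForm η) (hX : SmoothNear X x) (hY : SmoothNear Y x) (hZ : SmoothNear Z x) :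
    curv1 (qsConnection D A η) X Y Z x = curv1 D X Y Z x
      - (covForm D hη x (Y x) (X x) - covForm D hη x (X x) (Y x)) • A x (Z x) := by
  rw [curv1_apply, nabla1_qs_nabla1_qs hD hA hη X hY hZ, nabla1_qs_nabla1_qs hD hA hη Y hX hZ,
    nabla1_qsConnection, Pi.sub_apply, Pi.smul_apply', covForm_apply hη hX.diffAt,
    covForm_apply hη hY.diffAt, curv1_apply]
  simp only [EndField.app, CovectorField.app]
  rw [← nabla1_sub_nabla1 hD.torsion_free hX.diffAt hY.diffAt, map_sub]
  module

/-- The last two terms of `R³` jointly give `-∇_{[X,Y]}Z`, cancel `η(Z)A∇_Y X`, and complete the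
derivative of `η(Y)` to `∇η`. -/
theorem curv3_qs [T2Space M] (hD : IsLeviCivita D) (hA : IsKahler D A)
    (hη : SmoothForm η) (hX : SmoothNear X x) (hY : SmoothNear Y x) (hZ : SmoothNear Z x) :
    curv3 (qsConnection D A η) X Y Z x = curv1 D X Y Z x
      - covForm D hη x (Y x) (X x) • A x (Z x) + covForm D hη x (Z x) (Y x) • A x (X x)
      - (η x (Y x) * η x (A x (X x))) • A x (Z x)
      + (η x (Y x) * η x (A x (Z x))) • A x (X x) := by
  have hYX : SmoothNear (nabla1 (qsConnection D A η) Y X) x :=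
    smoothNear_sub_smul_app hD hA (hη.funSmoothNear_app hY) hY hX hX
  have h1 : nabla2 (qsConnection D A η) (nabla1 (qsConnection D A η) Y X) Z x
      = D Z x (nabla1 D Y X x) - η x (Y x) • D Z x (A x (X x))
        - η x (Z x) • (A x (nabla1 D Y X x) + η x (Y x) • X x) := by
    rw [nabla2_qsConnection hD.torsion_free hYX.diffAt hZ.diffAt, nabla1_qsConnection,
      Pi.sub_apply, Pi.smul_apply', app_sub_smul, nabla1_sub_left, nabla1_smul_left]
    simp only [EndField.app, CovectorField.app, nabla1, hA.sq, Pi.sub_apply, Pi.smul_apply']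
    module
  have h2 : nabla1 (qsConnection D A η) (nabla2 (qsConnection D A η) X Y) Z x
      = D Z x (nabla1 D X Y x) - η x (Y x) • D Z x (A x (X x))
        - (η x (nabla1 D X Y x) - η x (Y x) * η x (A x (X x))) • A x (Z x) := by
    rw [nabla1_qsConnection]
    simp only [EndField.app, CovectorField.app, nabla1, Pi.sub_apply, Pi.smul_apply']
    rw [nabla2_qsConnection hD.torsion_free hX.diffAt hY.diffAt]
    simp only [EndField.app, CovectorField.app, nabla1, Pi.sub_apply, Pi.smul_apply', map_sub,
      map_smul, smul_eq_mul]
  have h3 : curv3 (qsConnection D A η) X Y Z x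
      = nabla2 (qsConnection D A η) X (nabla1 (qsConnection D A η) Y Z) x
        - nabla1 (qsConnection D A η) Y (nabla2 (qsConnection D A η) X Z) x
        + nabla2 (qsConnection D A η) (nabla1 (qsConnection D A η) Y X) Z x
        - nabla1 (qsConnection D A η) (nabla2 (qsConnection D A η) X Y) Z x := rfl
  have h4 : nabla1 D (mlieBracket (𝓡 n) X Y) Z x
      = D Z x (nabla1 D X Y x) - D Z x (nabla1 D Y X x) := by
    rw [← map_sub, nabla1_sub_nabla1 hD.torsion_free hX.diffAt hY.diffAt]
    rfl
  rw [h3, h1, h2, nabla2_qs_nabla1_qs hD hA hη hX hY hZ, nabla1_qs_nabla2_qs hD hA hη Y hX hZ,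
    covForm_apply hη hY.diffAt, covForm_apply hη hZ.diffAt, curv1_apply, h4]
  module

/-- The terms `A∇_X Z` and `A∇_Y Z` cancel among the four second derivatives; `η(Z)A[X,Y]` cancels
against `∇²_{[X,Y]}Z`. -/
theorem curv5_qs [T2Space M] (hD : IsLeviCivita D) (hA : IsKahler D A)
    (hη : SmoothForm η) (hX : SmoothNear X x) (hY : SmoothNear Y x) (hZ : SmoothNear Z x) :
    curv5 (qsConnection D A η) X Y Z x = curv1 D X Y Z x + (1 / 2 : ℝ) •
      (-(covForm D hη x (Y x) (X x) - covForm D hη x (X x) (Y x)) • A x (Z x)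
        + covForm D hη x (Z x) (Y x) • A x (X x) - covForm D hη x (Z x) (X x) • A x (Y x)
        - (η x (X x) * η x (Y x)) • Z x - (η x (X x) * η x (A x (Z x))) • A x (Y x)
        + (η x (Z x) * η x (A x (Y x))) • A x (X x) + (η x (Y x) * η x (Z x)) • X x) := by
  have h3 : curv5 (qsConnection D A η) X Y Z x = (1 / 2 : ℝ) •
      (nabla1 (qsConnection D A η) X (nabla1 (qsConnection D A η) Y Z) x
        - nabla2 (qsConnection D A η) Y (nabla1 (qsConnection D A η) X Z) x
        + nabla2 (qsConnection D A η) X (nabla2 (qsConnection D A η) Y Z) x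
        - nabla1 (qsConnection D A η) Y (nabla2 (qsConnection D A η) X Z) x
        - nabla1 (qsConnection D A η) (mlieBracket (𝓡 n) X Y) Z x
        - nabla2 (qsConnection D A η) (mlieBracket (𝓡 n) X Y) Z x) := rfl
  rw [h3, nabla1_qs_nabla1_qs hD hA hη X hY hZ, nabla2_qs_nabla1_qs hD hA hη hY hX hZ,
    nabla2_qs_nabla2_qs hD hA hη hX hY hZ, nabla1_qs_nabla2_qs hD hA hη Y hX hZ,
    nabla2_qsConnection hD.torsion_free (hX.mlieBracket hY).diffAt hZ.diffAt,
    nabla1_qsConnection, Pi.sub_apply, Pi.smul_apply', Pi.sub_apply, Pi.smul_apply',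
    covForm_apply hη hX.diffAt, covForm_apply hη hY.diffAt, covForm_apply hη hZ.diffAt,
    covForm_apply hη hZ.diffAt, curv1_apply]
  simp only [EndField.app, CovectorField.app]
  rw [← nabla1_sub_nabla1 hD.torsion_free hX.diffAt hY.diffAt, map_sub, map_sub]
  module

end QuarterSymmetric

/-! ### Ricci-type traces and cancellation of the generator -/

section Traces

variable {n : ℕ} {M : Type*} [TopologicalSpace M] [ChartedSpace (EuclideanSpace ℝ (Fin n)) M]
  [IsManifold (𝓡 n) ∞ M] {D : AffineConnection n M} {A : EndField n M} {η : CovectorField n M}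
  {X Y Z : VF n M} {x : M}
  [Bundle.RiemannianBundle (fun x : M => TangentSpace (𝓡 n) x)]
  [IsContMDiffRiemannianBundle (𝓡 n) ∞ (EuclideanSpace ℝ (Fin n))
    (fun x : M => TangentSpace (𝓡 n) x)]

theorem IsKahler.trace (hA : IsKahler D A) (x : M) :
    LinearMap.trace ℝ (TangentSpace (𝓡 n) x) (A x).toLinearMap = 0 := by
  refine trace_eq_zero_of_inner_self _ fun u => ?_
  have h := hA.isometric x (A x u) u
  rw [hA.sq, inner_neg_left, real_inner_comm] at h
  change inner ℝ (A x u) u = 0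
  linarith

/-- A Kähler manifold is not one-dimensional. -/
theorem IsKahler.dim_ne_one (hA : IsKahler D A) (x : M) : n ≠ 1 := by
  intro hn
  have h : (A x).toLinearMap ∘ₗ (A x).toLinearMap = (-1 : ℝ) • LinearMap.id := by
    ext1 u
    simpa using hA.sq x u
  -- Determinants give `(det A)² = (-1)^n`, which is negative for `n = 1`.
  have hd := congrArg LinearMap.det h
  have hs : (-1 : ℝ) ^ n = -1 := by rw [hn, pow_one]
  rw [LinearMap.det_comp, LinearMap.det_smul, finrank_tangentSpace, hs, LinearMap.det_id] at hd
  nlinarith [mul_self_nonneg (LinearMap.det (A x).toLinearMap)]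

theorem ric_curv1_qs [T2Space M] (hD : IsLeviCivita D) (hA : IsKahler D A)
    (hη : SmoothForm η) (hY : SmoothNear Y x) (hZ : SmoothNear Z x) :
    ric (curv1 (qsConnection D A η)) Y Z x = ric (curv1 D) Y Z x
      - covForm D hη x (Y x) (A x (Z x)) + covForm D hη x (A x (Z x)) (Y x) := by
  rw [ric_curv1 hD.smooth hY hZ, ric, traceAt_eq (ricEnd hD.smooth hY hZ
    - (covForm D hη x (Y x) - (covForm D hη x).flip (Y x)).toLinearMap.smulRight (A x (Z x)))]
  · simp only [map_sub, LinearMap.trace_smulRight]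
    simp
    ring
  · intro u
    rw [curv1_qs hD hA hη (smoothNear_extend u) hY hZ, extend_apply_self]
    rfl

theorem ric_curv3_qs [T2Space M] (hD : IsLeviCivita D) (hA : IsKahler D A)
    (hη : SmoothForm η) (hY : SmoothNear Y x) (hZ : SmoothNear Z x) :
    ric (curv3 (qsConnection D A η)) Y Z x = ric (curv1 D) Y Z x
      - covForm D hη x (Y x) (A x (Z x)) + η x (Y x) * η x (Z x) := by
  rw [ric_curv1 hD.smooth hY hZ, ric, traceAt_eq (ricEnd hD.smooth hY hZ
    - (covForm D hη x (Y x)).toLinearMap.smulRight (A x (Z x))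
    + covForm D hη x (Z x) (Y x) • (A x).toLinearMap
    - (η x (Y x) • (η x).comp (A x)).toLinearMap.smulRight (A x (Z x))
    + (η x (Y x) * η x (A x (Z x))) • (A x).toLinearMap)]
  · simp only [map_sub, map_add, map_smul, LinearMap.trace_smulRight, hA.trace]
    simp [hA.sq]
  · intro u
    rw [curv3_qs hD hA hη (smoothNear_extend u) hY hZ, extend_apply_self]
    rfl

/-- The curvature part is traceless, so this trace depends on the generator alone and serves in `H⁵`
purely as a correction. -/
theorem ric'_curv3_qs [T2Space M] (hD : IsLeviCivita D) (hA : IsKahler D A)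
    (hη : SmoothForm η) (hX : SmoothNear X x) (hY : SmoothNear Y x) :
    ric' (curv3 (qsConnection D A η)) X Y x
      = covForm D hη x (A x (X x)) (Y x) - η x (X x) * η x (Y x) := by
  rw [ric', traceAt_eq (curvEnd hD.smooth hX hY
    - covForm D hη x (Y x) (X x) • (A x).toLinearMap
    + ((covForm D hη x).flip (Y x)).toLinearMap.smulRight (A x (X x))
    - (η x (Y x) * η x (A x (X x))) • (A x).toLinearMap
    + (η x (Y x) • (η x).comp (A x)).toLinearMap.smulRight (A x (X x)))]
  · simp only [map_sub, map_add, map_smul, LinearMap.trace_smulRight, hA.trace, trace_curvEnd hD]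
    simp [hA.sq]
    ring
  · intro u
    rw [curv3_qs hD hA hη hX hY (smoothNear_extend u), extend_apply_self]
    rfl

/-- The factor `n - 1` is the trace `n` of the identity minus the trace of the rank-one term
`η(·)Z`; it explains the normalization in `H⁵`. -/
theorem ric_curv5_qs [T2Space M] (hD : IsLeviCivita D) (hA : IsKahler D A)
    (hη : SmoothForm η) (hY : SmoothNear Y x) (hZ : SmoothNear Z x) :
    ric (curv5 (qsConnection D A η)) Y Z x = ric (curv1 D) Y Z x + (1 / 2) *
      (covForm D hη x (A x (Z x)) (Y x) - covForm D hη x (Y x) (A x (Z x))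
        - covForm D hη x (Z x) (A x (Y x)) - η x (A x (Y x)) * η x (A x (Z x))
        + (n - 1) * (η x (Y x) * η x (Z x))) := by
  rw [ric_curv1 hD.smooth hY hZ, ric, traceAt_eq (ricEnd hD.smooth hY hZ + (1 / 2 : ℝ) •
    (-(covForm D hη x (Y x) - (covForm D hη x).flip (Y x)).toLinearMap.smulRight (A x (Z x))
    + covForm D hη x (Z x) (Y x) • (A x).toLinearMap
    - (covForm D hη x (Z x)).toLinearMap.smulRight (A x (Y x))
    - η x (Y x) • (η x).toLinearMap.smulRight (Z x)
    - η x (A x (Z x)) • (η x).toLinearMap.smulRight (A x (Y x))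
    + (η x (Z x) * η x (A x (Y x))) • (A x).toLinearMap
    + (η x (Y x) * η x (Z x)) • LinearMap.id))]
  · simp only [map_sub, map_add, map_neg, map_smul, LinearMap.trace_smulRight, hA.trace,
      LinearMap.trace_id, finrank_tangentSpace]
    simp
    ring
  · intro u
    rw [curv5_qs hD hA hη (smoothNear_extend u) hY hZ, extend_apply_self]
    simp only [LinearMap.add_apply, LinearMap.sub_apply, LinearMap.smul_apply, LinearMap.neg_apply,
      LinearMap.smulRight_apply, LinearMap.id_apply, ContinuousLinearMap.coe_coe,
      sub_apply, ContinuousLinearMap.flip_apply, ricEnd_apply]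
    module

theorem H5_eq [T2Space M] (hD : IsLeviCivita D) (hA : IsKahler D A) (hη : SmoothForm η)
    (hX : SmoothNear X x) (hY : SmoothNear Y x) (hZ : SmoothNear Z x) :
    H5 D A η X Y Z x = curv1 D X Y Z x
      + (1 / (2 * ((n : ℝ) - 1))) • (ric (curv1 D) X Y x • Z x - ric (curv1 D) Y Z x • X x)
      + (1 / 2 : ℝ) • (ric (curv1 D) (A.app X) Y x • A x (Z x)
          - ric (curv1 D) (A.app Y) Z x • A x (X x)) := by
  -- Needed to cancel the factor `n - 1` of `Ric⁵` against the denominators of `H⁵`.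
  have hn : (n : ℝ) - 1 ≠ 0 := sub_ne_zero.2 (mod_cast hA.dim_ne_one x)
  have hAX := hX.app hA
  have hAY := hY.app hA
  have hAZ := hZ.app hA
  have app (W : VF n M) : A.app W x = A x (W x) := rfl
  simp only [H5]
  rw [curv5_qs hD hA hη hX hY hZ, ric_curv5_qs hD hA hη hX hY, ric_curv5_qs hD hA hη hY hZ,
    ric_curv1_qs hD hA hη hX hY, ric_curv1_qs hD hA hη hY hZ, ric_curv1_qs hD hA hη hY hAX,
    ric_curv3_qs hD hA hη hZ hAY, ric'_curv3_qs hD hA hη hAY hAX, ric'_curv3_qs hD hA hη hAZ hAY,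
    ric'_curv3_qs hD hA hη hAZ hX, ric_curv1_comm hD hAX hY, ric_curv1_comm hD hAY hZ]
  simp only [app, hA.sq, map_neg, neg_apply]
  match_scalars <;> field_simp <;> ring

end Traces

end KahlerQS

open KahlerQS in
theorem mainTheorem10 {n : ℕ} {M : Type*} [TopologicalSpace M] [T2Space M]
    [ChartedSpace (EuclideanSpace ℝ (Fin n)) M] [IsManifold (𝓡 n) ∞ M]
    [Bundle.RiemannianBundle (fun x : M => TangentSpace (𝓡 n) x)]
    [IsContMDiffRiemannianBundle (𝓡 n) ∞ (EuclideanSpace ℝ (Fin n))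
      (fun x : M => TangentSpace (𝓡 n) x)]
    (D : AffineConnection n M) (hD : IsLeviCivita D)
    (A : EndField n M) (hA : IsKahler D A) :
    (∀ η : CovectorField n M, SmoothForm η →
      ∀ X Y Z : VF n M, SmoothVF X → SmoothVF Y → SmoothVF Z → ∀ x : M,
        H5 D A η X Y Z x = curv1 D X Y Z x
          + (1 / (2 * ((n : ℝ) - 1))) •
              (ric (curv1 D) X Y x • Z x - ric (curv1 D) Y Z x • X x)
          + (1 / 2 : ℝ) •
              (ric (curv1 D) (A.app X) Y x • A x (Z x)
                - ric (curv1 D) (A.app Y) Z x • A x (X x))) ∧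
    (∀ η θ : CovectorField n M, SmoothForm η → SmoothForm θ →
      ∀ X Y Z : VF n M, SmoothVF X → SmoothVF Y → SmoothVF Z → ∀ x : M,
        H5 D A η X Y Z x = H5 D A θ X Y Z x) := by
  refine ⟨fun η hη X Y Z hX hY hZ x =>
    H5_eq hD hA hη (hX.smoothNear x) (hY.smoothNear x) (hZ.smoothNear x),
    fun η θ hη hθ X Y Z hX hY hZ x => ?_⟩
  rw [H5_eq hD hA hη (hX.smoothNear x) (hY.smoothNear x) (hZ.smoothNear x),
    H5_eq hD hA hθ (hX.smoothNear x) (hY.smoothNear x) (hZ.smoothNear x)]
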